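/- Let $n\ge 1$ and identify $\mathbb{C}^n$ with $\mathbb{R}^{2n}$, with real coordinates $x_1,\dots,x_{2n}$ (the real and imaginary parts of the complex coordinates). Let $\Omega\subset\mathbb{C}^n$ be a domain (a nonempty connected open set), and let $E\subset\Omega$ be closed in $\Omega$ with $\mathcal{H}^{2n-1}(E)=0$, where $\mathcal{H}^{2n-1}$ is the $(2n-1)$-dimensional Hausdorff measure. Let $f:\Omega\setminus E\to\mathbb{C}$ be holomorphic. If for each $j$, $1\le j\le 2n$, $\frac{\partial f}{\partial x_j}\in\mathcal{L}^2_{\mathrm{loc}}(\Omega)$, that is, $\left|\frac{\partial f}{\partial x_j}\right|^2$, which is defined outside the Lebesgue null set $E$, is locally integrable on $\Omega$ with respect to Lebesgue measure, then $f$ has a holomorphic extension to $\Omega$, that is, there is a holomorphic function $f^*:\Omega\to\mathbb{C}$ with $f^*=f$ on $\Omega\setminus E$. -/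

import Mathlib

open MeasureTheory Set

/-- The space `L^p_loc(Ω)`, `p > 0`: measurable functions `u` on `Ω ⊆ ℂⁿ = ℝ²ⁿ` for which `|u|^p` is
locally integrable on `Ω` with respect to Lebesgue measure. -/
structure MemLpLocOn {n : ℕ} (p : ℝ) (u : EuclideanSpace ℂ (Fin n) → ℂ)
    (Ω : Set (EuclideanSpace ℂ (Fin n))) : Prop where
  aestronglyMeasurable : AEStronglyMeasurable u (volume.restrict Ω)
  locallyIntegrableOn : LocallyIntegrableOn (fun z => ‖u z‖ ^ p) Ω volume

/-- The `2n` coordinate vectors of `ℝ²ⁿ = ℂⁿ`, indexed by `Fin n × Fin 2`: the index `(k, 0)` gives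
the vector `e_k` (direction of `Re z_k`), and `(k, 1)` gives `i e_k` (direction of `Im z_k`). -/
noncomputable def realCoordVec {n : ℕ} (j : Fin n × Fin 2) : EuclideanSpace ℂ (Fin n) :=
  EuclideanSpace.single j.1 (![1, Complex.I] j.2)

/-- The first partial derivative `∂f/∂x_j (z)` of `f` with respect to the real coordinate `x_j` of
`ℝ²ⁿ = ℂⁿ`. -/
noncomputable def realPartialDeriv {n : ℕ} (j : Fin n × Fin 2)
    (f : EuclideanSpace ℂ (Fin n) → ℂ) (z : EuclideanSpace ℂ (Fin n)) : ℂ :=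
  lineDeriv ℝ f z (realCoordVec j)

open Filter Topology ENNReal

/-! ### Sweeping sets of codimension-one Hausdorff measure zero -/

section NullSweep

variable {X Y : Type*} [MetricSpace X] [NormedAddCommGroup Y] [NormedSpace ℝ Y]
  [MeasurableSpace Y] [BorelSpace Y] [FiniteDimensional ℝ Y] {μ : Measure Y} [μ.IsAddHaarMeasure]

/-! Let `g` be the complex derivative of `f` on `Ω \ E`, extended by zero (`fderivOn`). The `L²`
hypothesis makes `g` locally integrable on `Ω`, and `E` is too small to be seen by line integrals:
moving an `H^(2n-1)`-null set along a one-parameter Lipschitz family sweeps out a Lebesgue null set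
(`measure_sweep_eq_zero`). So almost every segment in a fixed direction, and almost every ray from a
fixed point, misses `E`.

Rays from a point off `E` recover `f` from `g`, so `f` is locally integrable. Parallel segments give
integration by parts, so `g` is the weak derivative of `f` on all of `Ω`
(`integral_smul_fderivOn_apply`). A radial mollification of `f` then has as derivative the
mollification of `g`, which is complex linear; it is therefore holomorphic across `E`
(`differentiableAt_integral_radial_smul`).

Complex linearity of `g` also makes `f` weakly harmonic, which yields the mean value property at
every point off `E` (`integral_radial_smul_eq_of_mem`): the normalised mollification equals `f`
there. These local extensions glue because `Ω \ E` is dense in `Ω`. -/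

theorem measure_sweep_le_of_dist_le {m : ℕ} (hm : Module.finrank ℝ Y = m + 1) {T : Set X}
    {Φ : X → ℝ → Y} {K : ℝ} (hK : 0 ≤ K)
    (hΦ : ∀ x ∈ T, ∀ y ∈ T, ∀ s ∈ Icc (0 : ℝ) 1, ∀ t ∈ Icc (0 : ℝ) 1,
      dist (Φ x s) (Φ y t) ≤ K * (dist x y + |s - t|))
    {ρ : ℝ} (hρ : 0 < ρ) (hρ1 : ρ ≤ 1) (hT : ∀ x ∈ T, ∀ y ∈ T, dist x y ≤ ρ) :
    μ (image2 Φ T (Icc 0 1)) ≤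
      ENNReal.ofReal (2 * (2 * K) ^ (m + 1) * ρ ^ m) * μ (Metric.ball 0 1) := by
  -- Cut `[0, 1]` into at most `2 / ρ` pieces of length `ρ`. Each sweeps into a ball of radius
  -- `2Kρ`, so the total is of order `ρ⁻¹ ρ^(m+1) = ρ^m`.
  set N := ⌊1 / ρ⌋₊
  set S : ℕ → Set Y := fun k => image2 Φ T (Icc 0 1 ∩ Icc (k * ρ) ((k + 1) * ρ))
  have hsub : image2 Φ T (Icc 0 1) ⊆ ⋃ k ∈ Finset.range (N + 1), S k := by
    rintro _ ⟨x, hx, s, hs, rfl⟩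
    have h0 : 0 ≤ s / ρ := div_nonneg hs.1 hρ.le
    refine mem_iUnion₂.2 ⟨⌊s / ρ⌋₊, ?_, x, hx, s, ⟨hs, ?_, ?_⟩, rfl⟩
    · rw [Finset.mem_range, Nat.lt_succ_iff]
      exact Nat.floor_mono (by gcongr; exact hs.2)
    · exact (le_div_iff₀ hρ).1 (Nat.floor_le h0)
    · exact (div_le_iff₀ hρ).1 (Nat.lt_floor_add_one _).le
  have hS : ∀ k, μ (S k) ≤ ENNReal.ofReal ((2 * K * ρ) ^ (m + 1)) * μ (Metric.ball 0 1) := by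
    intro k
    rcases (S k).eq_empty_or_nonempty with h | ⟨_, ⟨x, hx, s, hs, rfl⟩⟩
    · simp [h]
    rw [← hm, ← Measure.addHaar_closedBall μ (Φ x s) (by positivity)]
    apply measure_mono
    rintro _ ⟨y, hy, t, ht, rfl⟩
    rw [Metric.mem_closedBall]
    refine (hΦ y hy x hx t ht.1 s hs.1).trans ?_
    have h1 := hT y hy x hx
    have h2 : |t - s| ≤ ρ := by
      have := ht.2; have := hs.2
      simp only [mem_Icc] at *
      rw [abs_le]; constructor <;> linarith
    nlinarith
  have hN : ((N + 1 : ℕ) : ℝ) ≤ 2 / ρ := by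
    have h1 : (N : ℝ) ≤ 1 / ρ := Nat.floor_le (by positivity)
    have h2 : 1 ≤ 1 / ρ := by rw [le_div_iff₀ hρ]; linarith
    push_cast
    have : 2 / ρ = 1 / ρ + 1 / ρ := by ring
    linarith
  calc μ (image2 Φ T (Icc 0 1)) ≤ μ (⋃ k ∈ Finset.range (N + 1), S k) := measure_mono hsub
    _ ≤ ∑ k ∈ Finset.range (N + 1), μ (S k) := measure_biUnion_finset_le _ _
    _ ≤ ∑ k ∈ Finset.range (N + 1),
        ENNReal.ofReal ((2 * K * ρ) ^ (m + 1)) * μ (Metric.ball 0 1) :=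
      Finset.sum_le_sum fun k _ => hS k
    _ = ENNReal.ofReal ((N + 1 : ℕ) * (2 * K * ρ) ^ (m + 1)) * μ (Metric.ball 0 1) := by
      rw [Finset.sum_const, Finset.card_range, nsmul_eq_mul,
        ENNReal.ofReal_mul (Nat.cast_nonneg _), ENNReal.ofReal_natCast, ← mul_assoc]
    _ ≤ ENNReal.ofReal (2 / ρ * (2 * K * ρ) ^ (m + 1)) * μ (Metric.ball 0 1) := by gcongr
    _ = _ := by
      congr 2
      field_simp
      ring

/-- The diameter may be zero, where the previous bound does not apply, so it is approached by `ρ`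
from above; the bound `2⁻¹` leaves room for `ρ ≤ 1`. -/
theorem measure_sweep_le_ediam {m : ℕ} (hm : Module.finrank ℝ Y = m + 1) {T : Set X}
    {Φ : X → ℝ → Y} {K : ℝ} (hK : 0 ≤ K)
    (hΦ : ∀ x ∈ T, ∀ y ∈ T, ∀ s ∈ Icc (0 : ℝ) 1, ∀ t ∈ Icc (0 : ℝ) 1,
      dist (Φ x s) (Φ y t) ≤ K * (dist x y + |s - t|))
    (hT : Metric.ediam T ≤ 2⁻¹) :
    μ (image2 Φ T (Icc 0 1)) ≤ ENNReal.ofReal (2 * (2 * K) ^ (m + 1)) * μ (Metric.ball 0 1) *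
      Metric.ediam T ^ m := by
  have hfin : Metric.ediam T ≠ ∞ := ne_top_of_le_ne_top (by simp) hT
  set r := (Metric.ediam T).toReal
  have hr : r < 1 := by
    have : r ≤ (2⁻¹ : ℝ≥0∞).toReal := ENNReal.toReal_mono (by simp) hT
    have h2 : (2⁻¹ : ℝ≥0∞).toReal = 2⁻¹ := by simp
    rw [h2] at this
    linarith [show (2⁻¹ : ℝ) < 1 by norm_num]
  have hd : ∀ x ∈ T, ∀ y ∈ T, dist x y ≤ r := by
    intro x hx y hy
    rw [dist_edist]
    exact ENNReal.toReal_mono hfin (Metric.edist_le_ediam_of_mem hx hy)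
  have hlim : Tendsto (fun ρ : ℝ => ENNReal.ofReal (2 * (2 * K) ^ (m + 1) * ρ ^ m) *
      μ (Metric.ball (0 : Y) 1)) (𝓝[>] r)
      (𝓝 (ENNReal.ofReal (2 * (2 * K) ^ (m + 1) * r ^ m) * μ (Metric.ball (0 : Y) 1))) := by
    refine ENNReal.Tendsto.mul_const ?_ (Or.inr measure_ball_lt_top.ne)
    refine (ENNReal.continuous_ofReal.tendsto _).comp (Tendsto.mono_left ?_ nhdsWithin_le_nhds)
    exact Continuous.tendsto (by fun_prop) r
  have hle : μ (image2 Φ T (Icc 0 1)) ≤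
      ENNReal.ofReal (2 * (2 * K) ^ (m + 1) * r ^ m) * μ (Metric.ball (0 : Y) 1) := by
    refine ge_of_tendsto hlim ?_
    filter_upwards [Ioc_mem_nhdsGT hr] with ρ hρ
    exact measure_sweep_le_of_dist_le hm hK hΦ (ENNReal.toReal_nonneg.trans_lt hρ.1) hρ.2
      fun x hx y hy => (hd x hx y hy).trans hρ.1.le
  refine hle.trans (le_of_eq ?_)
  rw [ENNReal.ofReal_mul (by positivity), ENNReal.ofReal_pow ENNReal.toReal_nonneg,
    ENNReal.ofReal_toReal hfin]
  ring

/-- Sweeping a set of vanishing codimension-one Hausdorff measure along a one-parameter family of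
maps that is jointly Lipschitz produces a null set. -/
theorem measure_sweep_eq_zero [MeasurableSpace X] [BorelSpace X] {m : ℕ}
    (hm : Module.finrank ℝ Y = m + 1) {E : Set X} {Φ : X → ℝ → Y} {K : ℝ} (hK : 0 ≤ K)
    (hΦ : ∀ x ∈ E, ∀ y ∈ E, ∀ s ∈ Icc (0 : ℝ) 1, ∀ t ∈ Icc (0 : ℝ) 1,
      dist (Φ x s) (Φ y t) ≤ K * (dist x y + |s - t|))
    (hE : Measure.hausdorffMeasure (m : ℝ) E = 0) :
    μ (image2 Φ E (Icc 0 1)) = 0 := by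
  set C := ENNReal.ofReal (2 * (2 * K) ^ (m + 1)) * μ (Metric.ball 0 1)
  have hC : C ≠ ∞ := ENNReal.mul_ne_top ENNReal.ofReal_ne_top measure_ball_lt_top.ne
  rw [Measure.hausdorffMeasure_apply] at hE
  -- Hausdorff measure is a supremum over mesh sizes; mesh `2⁻¹` alone supplies covers with
  -- arbitrarily small sum.
  have hE' := le_antisymm ((le_iSup₂ (2⁻¹ : ℝ≥0∞) (by simp)).trans hE.le) (zero_le)
  have key : ∀ ε : ℝ≥0∞, 0 < ε → μ (image2 Φ E (Icc 0 1)) ≤ C * ε := by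
    intro ε hε
    rw [← hE'] at hε
    simp only [iInf_lt_iff] at hε
    obtain ⟨t, hcov, hdiam, hsum⟩ := hε
    have hsub : image2 Φ E (Icc 0 1) ⊆ ⋃ i, image2 Φ (t i ∩ E) (Icc 0 1) := by
      rintro _ ⟨x, hx, s, hs, rfl⟩
      obtain ⟨i, hi⟩ := mem_iUnion.1 (hcov hx)
      exact mem_iUnion.2 ⟨i, x, ⟨hi, hx⟩, s, hs, rfl⟩
    calc μ (image2 Φ E (Icc 0 1)) ≤ ∑' i, μ (image2 Φ (t i ∩ E) (Icc 0 1)) :=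
          (measure_mono hsub).trans (measure_iUnion_le _)
      _ ≤ ∑' i, C * ⨆ (_ : (t i).Nonempty), Metric.ediam (t i) ^ (m : ℝ) := by
        refine ENNReal.tsum_le_tsum fun i => ?_
        rcases (t i).eq_empty_or_nonempty with h | h
        · simp [h]
        · refine (measure_sweep_le_ediam hm hK (fun x hx y hy => hΦ x hx.2 y hy.2)
            ((Metric.ediam_mono inter_subset_left).trans (hdiam i))).trans ?_
          rw [ciSup_pos h, ENNReal.rpow_natCast]
          gcongr
          exact inter_subset_left
      _ = C * ∑' i, ⨆ (_ : (t i).Nonempty), Metric.ediam (t i) ^ (m : ℝ) := ENNReal.tsum_mul_left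
      _ ≤ C * ε := by gcongr
  have hlim : Tendsto (fun ε : ℝ≥0∞ => C * ε) (𝓝[>] 0) (𝓝 (C * 0)) :=
    (ENNReal.Tendsto.const_mul tendsto_id (Or.inr hC)).mono_left nhdsWithin_le_nhds
  rw [mul_zero] at hlim
  exact le_antisymm (ge_of_tendsto hlim (by
    filter_upwards [self_mem_nhdsWithin] with ε hε using key ε hε)) (zero_le)

end NullSweep

/-! ### Almost every segment or ray misses the exceptional set -/

section Segments

variable {X : Type*} [NormedAddCommGroup X] [NormedSpace ℝ X]
  [MeasurableSpace X] [BorelSpace X] [FiniteDimensional ℝ X] {μ : Measure X} [μ.IsAddHaarMeasure]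

/-- Almost every segment in a fixed direction misses a set of vanishing codimension-one
Hausdorff measure. -/
theorem ae_add_smul_notMem {m : ℕ} (hm : Module.finrank ℝ X = m + 1) {E : Set X}
    (hE : Measure.hausdorffMeasure (m : ℝ) E = 0) (v : X) :
    ∀ᵐ x ∂μ, ∀ t ∈ Icc (0 : ℝ) 1, x + t • v ∉ E := by
  have h0 : μ (image2 (fun x (t : ℝ) => x - t • v) E (Icc 0 1)) = 0 := by
    refine measure_sweep_eq_zero hm (K := max 1 ‖v‖) (by positivity) ?_ hE
    intro x _ y _ s _ t _
    have : x - s • v - (y - t • v) = (x - y) - (s - t) • v := by module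
    rw [dist_eq_norm, this, dist_eq_norm]
    refine (norm_sub_le _ _).trans ?_
    rw [norm_smul, Real.norm_eq_abs, mul_add]
    have h1 := le_max_left 1 ‖v‖
    have h2 := le_max_right 1 ‖v‖
    have := mul_le_mul_of_nonneg_right h1 (norm_nonneg (x - y))
    have := mul_le_mul_of_nonneg_right h2 (abs_nonneg (s - t))
    linarith
  refine measure_mono_null ?_ h0
  intro x hx
  simp only [mem_compl_iff, mem_ofPred_eq, not_forall, not_not] at hx
  obtain ⟨t, ht, hxt⟩ := hx
  exact ⟨x + t • v, hxt, t, ht, by simp⟩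

/-- Almost every segment issuing from a fixed point misses, apart from that point, a set of
vanishing codimension-one Hausdorff measure. -/
theorem ae_ray_notMem {m : ℕ} (hm : Module.finrank ℝ X = m + 1) {E : Set X}
    (hE : Measure.hausdorffMeasure (m : ℝ) E = 0) (z : X) :
    ∀ᵐ w ∂μ, ∀ t ∈ Ioc (0 : ℝ) 1, z + t • w ∉ E := by
  -- A bad `w` is `(x - z) / t` with `x ∈ E`. Since `1 / t` is unbounded, write it as `1 + k * s`
  -- with `s ∈ [0, 1]`, restrict `x` to a ball of radius `k` to keep the family Lipschitz, and take
  -- the union over `k`.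
  have h0 : ∀ k : ℕ, μ (image2 (fun x (s : ℝ) => (1 + k * s) • (x - z))
      (E ∩ Metric.closedBall z k) (Icc 0 1)) = 0 := by
    intro k
    refine measure_sweep_eq_zero hm (K := 1 + k + k * k) (by positivity) ?_
      (measure_mono_null inter_subset_left hE)
    intro x hx y hy s hs t ht
    have : (1 + k * s) • (x - z) - (1 + k * t) • (y - z)
      = (1 + k * s) • (x - y) + (k * (s - t)) • (y - z) := by module
    rw [dist_eq_norm, this, dist_eq_norm]
    refine (norm_add_le _ _).trans ?_
    have hk : (0 : ℝ) ≤ k := Nat.cast_nonneg k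
    rw [norm_smul, norm_smul, Real.norm_eq_abs, Real.norm_eq_abs, abs_mul, abs_of_nonneg hk,
      abs_of_nonneg (by nlinarith [hs.1] : 0 ≤ 1 + k * s)]
    have h1 : ‖y - z‖ ≤ k := by simpa [dist_eq_norm] using hy.2
    have h2 : (1 + k * s) * ‖x - y‖ ≤ (1 + k) * ‖x - y‖ := by
      gcongr; nlinarith [hs.2]
    have h3 : k * |s - t| * ‖y - z‖ ≤ k * |s - t| * k := by gcongr
    have h4 := norm_nonneg (x - y)
    have h5 := abs_nonneg (s - t)
    nlinarith [mul_nonneg (mul_nonneg hk hk) h4, mul_nonneg hk h5]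
  refine measure_mono_null ?_ (measure_iUnion_null h0)
  intro w hw
  simp only [mem_compl_iff, mem_ofPred_eq, not_forall, not_not] at hw
  obtain ⟨t, ht, hwt⟩ := hw
  obtain ⟨k, hk⟩ := exists_nat_ge (max ‖w‖ (1 / t))
  have hk1 := (le_max_left _ _).trans hk
  have hk2 := (le_max_right _ _).trans hk
  have hk0 : (0 : ℝ) < k := (one_div_pos.2 ht.1).trans_le hk2
  refine mem_iUnion.2 ⟨k, z + t • w, ⟨hwt, ?_⟩, (1 / t - 1) / k, ⟨?_, ?_⟩, ?_⟩
  · rw [Metric.mem_closedBall, dist_eq_norm, add_sub_cancel_left, norm_smul, Real.norm_eq_abs,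
      abs_of_pos ht.1]
    nlinarith [ht.2, norm_nonneg w]
  · apply div_nonneg _ hk0.le
    have : 1 ≤ 1 / t := by rw [le_div_iff₀ ht.1]; linarith [ht.2]
    linarith
  · rw [div_le_one hk0]; linarith
  · have : 1 + (k : ℝ) * ((1 / t - 1) / k) = 1 / t := by field_simp; ring
    simp only [this, add_sub_cancel_left, smul_smul]
    rw [one_div_mul_cancel ht.1.ne', one_smul]

end Segments

/-! ### Fubini along rays and along parallel segments -/

section Dilation

variable {X : Type*} [NormedAddCommGroup X] [NormedSpace ℝ X]
  [MeasurableSpace X] [BorelSpace X] [FiniteDimensional ℝ X] {μ : Measure X} [μ.IsAddHaarMeasure]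

theorem lintegral_comp_add_smul {h : X → ℝ≥0∞} (hh : Measurable h) (z : X) {t : ℝ} (ht : t ≠ 0) :
    ∫⁻ w, h (z + t • w) ∂μ = ENNReal.ofReal |(t ^ Module.finrank ℝ X)⁻¹| * ∫⁻ x, h x ∂μ := by
  have hm : Measurable fun w : X => h (z + w) := hh.comp (measurable_const_add z)
  have h1 : ∫⁻ w, h (z + t • w) ∂μ = ∫⁻ w, h (z + w) ∂(Measure.map (t • ·) μ) :=
    (lintegral_map hm (measurable_const_smul t)).symm
  rw [h1, Measure.map_addHaar_smul μ ht, lintegral_smul_measure, smul_eq_mul,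
    lintegral_add_left_eq_self]

/-- The radial average of an integrable function that is bounded near the centre is integrable. -/
theorem lintegral_lintegral_ray_lt_top {h : X → ℝ≥0∞} (hh : Measurable h) {z : X}
    (hfin : ∫⁻ x, h x ∂μ < ∞) {δ : ℝ} (hδ : 0 < δ) {M : ℝ≥0∞} (hM : M < ∞)
    (hb : ∀ x ∈ Metric.ball z δ, h x ≤ M) (R : ℝ) :
    ∫⁻ w in Metric.closedBall 0 R, ∫⁻ t in Ioc (0 : ℝ) 1, h (z + t • w) ∂volume ∂μ < ∞ := by
  -- For `t < c` the point `z + t • w` stays in the ball where `h ≤ M`; for `t ≥ c` the Jacobian of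
  -- the dilation is at most `c` to the power minus the dimension.
  set c := δ / (|R| + 1)
  have hc : 0 < c := by positivity
  set C := M * μ (Metric.closedBall 0 R) +
    ENNReal.ofReal ((c ^ Module.finrank ℝ X)⁻¹) * ∫⁻ x, h x ∂μ
  have hC : C < ∞ := ENNReal.add_lt_top.2
    ⟨ENNReal.mul_lt_top hM measure_closedBall_lt_top,
      ENNReal.mul_lt_top ENNReal.ofReal_lt_top hfin⟩
  rw [lintegral_lintegral_swap (by
    refine (hh.comp ?_).aemeasurable
    fun_prop)]
  calc ∫⁻ t in Ioc (0 : ℝ) 1, ∫⁻ w in Metric.closedBall 0 R, h (z + t • w) ∂μ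
      ≤ ∫⁻ _ in Ioc (0 : ℝ) 1, C := by
        refine setLIntegral_mono measurable_const fun t ht => ?_
        rcases lt_or_ge t c with htc | htc
        · refine le_trans ?_ le_self_add
          calc ∫⁻ w in Metric.closedBall 0 R, h (z + t • w) ∂μ
              ≤ ∫⁻ _ in Metric.closedBall 0 R, M ∂μ := by
                refine setLIntegral_mono measurable_const fun w hw => hb _ ?_
                rw [Metric.mem_ball, dist_eq_norm, add_sub_cancel_left, norm_smul,
                  Real.norm_eq_abs, abs_of_pos ht.1]
                have hw' : ‖w‖ ≤ |R| := (by simpa using hw : ‖w‖ ≤ R).trans (le_abs_self R)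
                have h1 : c * (|R| + 1) = δ := by simp only [c]; field_simp
                nlinarith [ht.1, norm_nonneg w]
            _ = M * μ (Metric.closedBall 0 R) := by simp
        · refine le_trans ?_ le_add_self
          refine (setLIntegral_le_lintegral _ _).trans ?_
          rw [lintegral_comp_add_smul hh z ht.1.ne', abs_of_pos (by have := ht.1; positivity)]
          gcongr
    _ < ∞ := by simpa using hC

/-- If `u` is integrable and has an integrable derivative in the direction `v` along almost every
segment parallel to `v`, then that derivative has integral zero. -/
theorem integral_eq_zero_of_hasDerivAt_segment {u u' : X → ℂ} (hu : Integrable u μ)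
    (hu' : Integrable u' μ) (hmeas : Measurable u') (v : X)
    (h : ∀ᵐ x ∂μ, ∀ t ∈ Icc (0 : ℝ) 1,
      HasDerivAt (fun τ : ℝ => u (x + τ • v)) (u' (x + t • v)) t) :
    ∫ x, u' x ∂μ = 0 := by
  have hint : Integrable (fun p : X × ℝ => u' (p.1 + p.2 • v))
      (μ.prod (volume.restrict (Ioc 0 1))) := by
    have hm : Measurable fun p : X × ℝ => u' (p.1 + p.2 • v) := hmeas.comp (by fun_prop)
    rw [integrable_prod_iff' hm.aestronglyMeasurable]
    refine ⟨Eventually.of_forall fun t => hu'.comp_add_right (t • v), ?_⟩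
    have : ∀ t : ℝ, ∫ x, ‖u' (x + t • v)‖ ∂μ = ∫ x, ‖u' x‖ ∂μ := fun t =>
      integral_add_right_eq_self (fun x => ‖u' x‖) _
    simp only [this]
    exact integrable_const _
  have hFTC : ∀ᵐ x ∂μ, ∫ t in Ioc (0 : ℝ) 1, u' (x + t • v) = u (x + v) - u x := by
    filter_upwards [h, hint.prod_right_ae] with x hx hxi
    have := intervalIntegral.integral_eq_sub_of_hasDerivAt (a := 0) (b := 1)
      (f := fun τ : ℝ => u (x + τ • v)) (f' := fun t => u' (x + t • v))
      (fun t ht => hx t (by simpa [uIcc_of_le] using ht))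
      ((intervalIntegrable_iff_integrableOn_Ioc_of_le zero_le_one).2 hxi)
    rw [intervalIntegral.integral_of_le zero_le_one] at this
    simpa using this
  -- The two translates of `u` have equal integrals; after Fubini the left side is a `t`-average of
  -- the constant `∫ u'`.
  have h1 : ∫ x, (∫ t in Ioc (0 : ℝ) 1, u' (x + t • v)) ∂μ = 0 := by
    rw [integral_congr_ae hFTC, integral_sub (hu.comp_add_right v) hu,
      integral_add_right_eq_self, sub_self]
  rw [integral_integral_swap hint] at h1
  have h2 : ∀ t : ℝ, ∫ x, u' (x + t • v) ∂μ = ∫ x, u' x ∂μ := fun t =>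
    integral_add_right_eq_self u' _
  simpa [h2] using h1

end Dilation

/-! ### Recovering the function from its derivative along rays -/

section Ray

variable {n : ℕ} {m : ℕ} {Ω E : Set (EuclideanSpace ℂ (Fin n))} {f : EuclideanSpace ℂ (Fin n) → ℂ}

/-- The complex derivative of `f` on `U`, extended by zero. -/
noncomputable def fderivOn (U : Set (EuclideanSpace ℂ (Fin n))) (f : EuclideanSpace ℂ (Fin n) → ℂ) :
    EuclideanSpace ℂ (Fin n) → EuclideanSpace ℂ (Fin n) →L[ℂ] ℂ :=
  U.indicator (fderiv ℂ f)

theorem measurable_fderivOn {U : Set (EuclideanSpace ℂ (Fin n))} (hU : IsOpen U) :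
    Measurable (fderivOn U f) :=
  (measurable_fderiv ℂ f).indicator hU.measurableSet

theorem hasFDerivAt_fderivOn {U : Set (EuclideanSpace ℂ (Fin n))} (hU : IsOpen U)
    (hf : DifferentiableOn ℂ f U) {x : EuclideanSpace ℂ (Fin n)} (hx : x ∈ U) :
    HasFDerivAt f (fderivOn U f x) x := by
  rw [fderivOn, indicator_of_mem hx]
  exact ((hf x hx).differentiableAt (hU.mem_nhds hx)).hasFDerivAt

theorem hasDerivAt_segment_fderivOn {U : Set (EuclideanSpace ℂ (Fin n))} (hU : IsOpen U)
    (hf : DifferentiableOn ℂ f U) {x v : EuclideanSpace ℂ (Fin n)} {t : ℝ} (hx : x + t • v ∈ U) :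
    HasDerivAt (fun τ : ℝ => f (x + τ • v)) (fderivOn U f (x + t • v) v) t := by
  have h1 := (hasFDerivAt_fderivOn hU hf hx).restrictScalars ℝ
  have h2 : HasDerivAt (fun τ : ℝ => x + τ • v) v t := by
    simpa using ((hasDerivAt_id t).smul_const v).const_add x
  exact h1.comp_hasDerivAt t h2

/-- Cauchy's estimate on balls of radius `r / 2`, where `f` stays within `2` of its central value.
-/
theorem exists_ball_norm_fderivOn_le {U : Set (EuclideanSpace ℂ (Fin n))} (hU : IsOpen U)
    (hf : DifferentiableOn ℂ f U) {z : EuclideanSpace ℂ (Fin n)} (hz : z ∈ U) :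
    ∃ δ > 0, ∃ M : ℝ, ∀ x ∈ Metric.ball z δ, ‖fderivOn U f x‖ ≤ M := by
  have hc : ContinuousAt f z := (hf z hz).continuousWithinAt.continuousAt (hU.mem_nhds hz)
  obtain ⟨r, hr, hball⟩ := Metric.mem_nhds_iff.1
    (inter_mem (hU.mem_nhds hz) (hc.preimage_mem_nhds (Metric.ball_mem_nhds _ one_pos)))
  refine ⟨r / 2, by positivity, 2 / (r / 2), fun x hx => ?_⟩
  have hsub : Metric.ball x (r / 2) ⊆ Metric.ball z r := by
    refine Metric.ball_subset_ball' ?_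
    rw [Metric.mem_ball] at hx
    linarith
  have hxz := hball (hsub (Metric.mem_ball_self (by positivity)))
  rw [fderivOn, indicator_of_mem hxz.1]
  refine Complex.norm_fderiv_le_div_of_mapsTo_ball
    (hf.mono (hsub.trans (hball.trans inter_subset_left))) (fun y hy => ?_) (by positivity)
  have h1 : dist (f y) (f z) < 1 := (hball (hsub hy)).2
  have h2 : dist (f x) (f z) < 1 := hxz.2
  rw [Metric.mem_closedBall]
  linarith [dist_triangle_right (f y) (f x) (f z)]

/-- Averaging over rays weights `‖g‖` by a kernel singular at `z`; as `z ∉ E`, `g` is bounded near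
`z` and the singularity is harmless. -/
theorem integrable_fderivOn_ray (hU : IsOpen (Ω \ E)) (hf : DifferentiableOn ℂ f (Ω \ E))
    {z : EuclideanSpace ℂ (Fin n)} (hz : z ∈ Ω \ E) {R : ℝ}
    (hg : IntegrableOn (fderivOn (Ω \ E) f) (Metric.closedBall z R)) :
    Integrable (fun p : EuclideanSpace ℂ (Fin n) × ℝ => fderivOn (Ω \ E) f (z + p.2 • p.1))
      ((volume.restrict (Metric.closedBall 0 R)).prod (volume.restrict (Ioc 0 1))) := by
  set g := fderivOn (Ω \ E) f
  have hgm : Measurable g := measurable_fderivOn hU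
  have hcomp : Measurable fun p : EuclideanSpace ℂ (Fin n) × ℝ => g (z + p.2 • p.1) :=
    hgm.comp (by fun_prop)
  refine ⟨hcomp.aestronglyMeasurable, ?_⟩
  rw [hasFiniteIntegral_iff_enorm, lintegral_prod _ hcomp.enorm.aemeasurable]
  obtain ⟨δ, hδ, M, hM⟩ := exists_ball_norm_fderivOn_le hU hf hz
  set h := (Metric.closedBall z R).indicator fun x => ‖g x‖ₑ
  have hh : Measurable h := hgm.enorm.indicator Metric.isClosed_closedBall.measurableSet
  refine lt_of_le_of_lt ?_ (lintegral_lintegral_ray_lt_top (μ := volume) (z := z) hh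
    (by rw [lintegral_indicator Metric.isClosed_closedBall.measurableSet]; exact hg.2)
    hδ (M := ENNReal.ofReal M) ENNReal.ofReal_lt_top (fun x hx => ?_) R)
  · refine setLIntegral_mono' Metric.isClosed_closedBall.measurableSet fun w hw =>
      setLIntegral_mono' measurableSet_Ioc fun t ht => ?_
    refine (indicator_of_mem (f := fun x => ‖g x‖ₑ) ?_).ge
    rw [Metric.mem_closedBall, dist_eq_norm, add_sub_cancel_left, norm_smul, Real.norm_eq_abs,
      abs_of_pos ht.1]
    have : ‖w‖ ≤ R := by simpa using hw
    nlinarith [ht.1, ht.2, norm_nonneg w]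
  · refine (indicator_le_self _ _ x).trans ?_
    rw [← ofReal_norm]
    exact ENNReal.ofReal_le_ofReal (hM x hx)

theorem integrable_fderivOn_ray_apply (hU : IsOpen (Ω \ E)) (hf : DifferentiableOn ℂ f (Ω \ E))
    {z : EuclideanSpace ℂ (Fin n)} (hz : z ∈ Ω \ E) {R : ℝ}
    (hg : IntegrableOn (fderivOn (Ω \ E) f) (Metric.closedBall z R)) :
    Integrable (fun p : EuclideanSpace ℂ (Fin n) × ℝ => fderivOn (Ω \ E) f (z + p.2 • p.1) p.1)
      ((volume.restrict (Metric.closedBall 0 R)).prod (volume.restrict (Ioc 0 1))) := by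
  have h1 := integrable_fderivOn_ray hU hf hz hg
  refine (h1.norm.const_mul R).mono' ?_ ?_
  · exact ((ContinuousLinearMap.apply ℂ ℂ).flip.aestronglyMeasurable_comp₂ h1.aestronglyMeasurable
      measurable_fst.aestronglyMeasurable)
  · have : ∀ᵐ p ∂((volume.restrict (Metric.closedBall (0 : EuclideanSpace ℂ (Fin n)) R)).prod
        (volume.restrict (Ioc (0 : ℝ) 1))), p.1 ∈ Metric.closedBall 0 R :=
      Measure.quasiMeasurePreserving_fst.ae
        (ae_restrict_mem Metric.isClosed_closedBall.measurableSet)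
    filter_upwards [this] with p hp
    refine (ContinuousLinearMap.le_opNorm _ _).trans ?_
    rw [mul_comm]
    gcongr
    simpa using hp

theorem ae_sub_eq_integral_ray (hm : Module.finrank ℝ (EuclideanSpace ℂ (Fin n)) = m + 1)
    (hE : Measure.hausdorffMeasure (m : ℝ) E = 0) (hU : IsOpen (Ω \ E)) (hf : DifferentiableOn ℂ f (Ω \ E))
    {z : EuclideanSpace ℂ (Fin n)} (hz : z ∈ Ω \ E) {R : ℝ} (hR : Metric.closedBall z R ⊆ Ω)
    (hg : IntegrableOn (fderivOn (Ω \ E) f) (Metric.closedBall z R)) :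
    ∀ᵐ w ∂(volume.restrict (Metric.closedBall 0 R)),
      f (z + w) - f z = ∫ t in Ioc (0 : ℝ) 1, fderivOn (Ω \ E) f (z + t • w) w := by
  filter_upwards [ae_restrict_of_ae (ae_ray_notMem hm hE z),
    ae_restrict_mem Metric.isClosed_closedBall.measurableSet,
    (integrable_fderivOn_ray_apply hU hf hz hg).prod_right_ae] with w hw hwR hwi
  have hseg : ∀ t ∈ Icc (0 : ℝ) 1, z + t • w ∈ Ω \ E := by
    intro t ht
    rcases ht.1.eq_or_lt with rfl | ht0
    · simpa using hz
    refine ⟨hR ?_, hw t ⟨ht0, ht.2⟩⟩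
    rw [Metric.mem_closedBall, dist_eq_norm, add_sub_cancel_left, norm_smul, Real.norm_eq_abs,
      abs_of_pos ht0]
    have : ‖w‖ ≤ R := by simpa using hwR
    nlinarith [ht.1, ht.2, norm_nonneg w]
  have := intervalIntegral.integral_eq_sub_of_hasDerivAt (a := 0) (b := 1)
    (f := fun τ : ℝ => f (z + τ • w))
    (fun t ht => hasDerivAt_segment_fderivOn hU hf (hseg t (by simpa [uIcc_of_le] using ht)))
    ((intervalIntegrable_iff_integrableOn_Ioc_of_le zero_le_one).2 hwi)
  rw [intervalIntegral.integral_of_le zero_le_one] at this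
  simpa using this.symm

theorem integrableOn_closedBall_of_ray (hm : Module.finrank ℝ (EuclideanSpace ℂ (Fin n)) = m + 1)
    (hE : Measure.hausdorffMeasure (m : ℝ) E = 0) (hU : IsOpen (Ω \ E))
    (hf : DifferentiableOn ℂ f (Ω \ E))
    {z : EuclideanSpace ℂ (Fin n)} (hz : z ∈ Ω \ E) {R : ℝ} (hR : Metric.closedBall z R ⊆ Ω)
    (hg : IntegrableOn (fderivOn (Ω \ E) f) (Metric.closedBall z R)) :
    IntegrableOn f (Metric.closedBall z R) := by
  have h1 := (integrable_fderivOn_ray_apply hU hf hz hg).integral_prod_left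
  have h2 : IntegrableOn (fun w => f (z + w)) (Metric.closedBall 0 R) := by
    have : IsFiniteMeasure (volume.restrict
        (Metric.closedBall (0 : EuclideanSpace ℂ (Fin n)) R)) :=
      ⟨by simpa using measure_closedBall_lt_top⟩
    refine ((integrable_const (f z)).add h1).congr ?_
    filter_upwards [ae_sub_eq_integral_ray hm hE hU hf hz hR hg] with w hw
    simp [← hw]
  have hpre : Metric.closedBall (0 : EuclideanSpace ℂ (Fin n)) R =
      (z + ·) ⁻¹' Metric.closedBall z R := by
    ext w; simp [dist_eq_norm]
  rw [hpre] at h2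
  exact ((measurePreserving_add_left volume z).integrableOn_comp_preimage
    (measurableEmbedding_addLeft z)).1 h2

end Ray

/-! ### Local integrability of the derivative and of the function -/

section LocalIntegrability

variable {n : ℕ} {m : ℕ} {Ω E : Set (EuclideanSpace ℂ (Fin n))} {f : EuclideanSpace ℂ (Fin n) → ℂ}

theorem EuclideanSpace.eq_sum_smul_single (y : EuclideanSpace ℂ (Fin n)) :
    y = ∑ k, y k • EuclideanSpace.single k (1 : ℂ) := by
  ext i
  simp [Finset.sum_apply, Pi.single_apply]

theorem norm_clm_le_sum_single (L : EuclideanSpace ℂ (Fin n) →L[ℂ] ℂ) :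
    ‖L‖ ≤ ∑ k, ‖L (EuclideanSpace.single k 1)‖ := by
  refine L.opNorm_le_bound (Finset.sum_nonneg fun _ _ => norm_nonneg _) fun y => ?_
  conv_lhs => rw [EuclideanSpace.eq_sum_smul_single y, map_sum]
  rw [Finset.sum_mul]
  refine (norm_sum_le _ _).trans (Finset.sum_le_sum fun k _ => ?_)
  rw [map_smul, norm_smul, mul_comm]
  gcongr
  exact PiLp.norm_apply_le y k

/-- By complex linearity the derivatives in the directions `Re z_k` control the whole operator norm,
and `s ≤ 1 + s ^ 2` passes from square integrability to integrability. -/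
theorem locallyIntegrableOn_fderivOn (hΩ : IsOpen Ω) (hU : IsOpen (Ω \ E))
    (hf : DifferentiableOn ℂ f (Ω \ E))
    (hL2 : ∀ j : Fin n × Fin 2, MemLpLocOn 2 (realPartialDeriv j f) Ω) :
    LocallyIntegrableOn (fderivOn (Ω \ E) f) Ω := by
  rw [locallyIntegrableOn_iff hΩ.isLocallyClosed]
  intro K hKΩ hK
  have hbound : IntegrableOn (fun x => ∑ k : Fin n, (1 + ‖realPartialDeriv (k, 0) f x‖ ^ (2 : ℝ)))
      K := by
    refine integrable_finsetSum _ fun k _ => ?_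
    exact (integrableOn_const (by exact hK.measure_lt_top.ne)).add
      ((hL2 (k, 0)).locallyIntegrableOn.integrableOn_compact_subset hKΩ hK)
  refine hbound.mono' (measurable_fderivOn hU).aestronglyMeasurable
    (Eventually.of_forall fun x => ?_)
  by_cases hx : x ∈ Ω \ E
  · refine (norm_clm_le_sum_single _).trans (Finset.sum_le_sum fun k _ => ?_)
    have h1 : realPartialDeriv (k, 0) f x
        = fderivOn (Ω \ E) f x (EuclideanSpace.single k 1) := by
      have := ((hasFDerivAt_fderivOn hU hf hx).restrictScalars ℝ).hasLineDerivAt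
        (realCoordVec (k, 0))
      rw [realPartialDeriv, this.lineDeriv]
      simp [realCoordVec]
    rw [h1, Real.rpow_two]
    nlinarith [sq_nonneg (‖fderivOn (Ω \ E) f x (EuclideanSpace.single k 1)‖ - 1),
      norm_nonneg (fderivOn (Ω \ E) f x (EuclideanSpace.single k 1))]
  · rw [fderivOn, indicator_of_notMem hx, norm_zero]
    exact Finset.sum_nonneg fun k _ => by positivity

theorem volume_eq_zero_of_hausdorffMeasure
    (hm : Module.finrank ℝ (EuclideanSpace ℂ (Fin n)) = m + 1)
    (hE : Measure.hausdorffMeasure (m : ℝ) E = 0) : volume E = 0 := by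
  -- In direction `0` the segments are single points.
  have := ae_add_smul_notMem (μ := volume) hm hE 0
  refine measure_mono_null (fun x hx => ?_) this
  simp only [mem_compl_iff, mem_ofPred_eq, not_forall, not_not]
  exact ⟨0, by simp, by simpa using hx⟩

theorem subset_closure_diff_of_volume_eq_zero (hΩ : IsOpen Ω) (hE : volume E = 0) :
    Ω ⊆ closure (Ω \ E) := by
  intro x hx
  rw [mem_closure_iff]
  intro V hV hxV
  by_contra hcon
  have hsub : V ∩ Ω ⊆ E := fun y hy => by
    by_contra hyE
    exact hcon ⟨y, hy.1, hy.2, hyE⟩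
  exact ((hV.inter hΩ).measure_pos volume ⟨x, hxV, hx⟩).ne' (measure_mono_null hsub hE)

theorem locallyIntegrableOn_of_fderivOn
    (hm : Module.finrank ℝ (EuclideanSpace ℂ (Fin n)) = m + 1)
    (hE : Measure.hausdorffMeasure (m : ℝ) E = 0) (hΩ : IsOpen Ω) (hU : IsOpen (Ω \ E))
    (hf : DifferentiableOn ℂ f (Ω \ E)) (hg : LocallyIntegrableOn (fderivOn (Ω \ E) f) Ω) :
    LocallyIntegrableOn f Ω := by
  intro z₀ hz₀
  -- `z₀` may lie in `E`, so rays start from a point `z` off `E` within `ε / 4`; the ball of radius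
  -- `ε / 2` about `z` still covers a neighbourhood of `z₀`.
  obtain ⟨ε, hε, hball⟩ := Metric.isOpen_iff.1 hΩ z₀ hz₀
  obtain ⟨z, hzU, hz⟩ := Metric.mem_closure_iff.1 (subset_closure_diff_of_volume_eq_zero hΩ
    (volume_eq_zero_of_hausdorffMeasure hm hE) hz₀) (ε / 4) (by positivity)
  have hsub : Metric.closedBall z (ε / 2) ⊆ Ω := fun x hx => hball <| by
    rw [Metric.mem_closedBall] at hx
    rw [Metric.mem_ball]
    linarith [dist_triangle_right x z₀ z]
  have h1 := integrableOn_closedBall_of_ray hm hE hU hf hzU hsub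
    (hg.integrableOn_compact_subset hsub (isCompact_closedBall z _))
  refine ⟨Metric.ball z₀ (ε / 4), mem_nhdsWithin_of_mem_nhds (Metric.ball_mem_nhds _ (by positivity)),
    h1.mono_set fun x hx => ?_⟩
  rw [Metric.mem_ball] at hx
  rw [Metric.mem_closedBall]
  linarith [dist_triangle x z₀ z]

end LocalIntegrability

theorem ContinuousOn.measurable_indicator {X Y : Type*} [TopologicalSpace X] [MeasurableSpace X]
    [BorelSpace X] [TopologicalSpace Y] [MeasurableSpace Y] [BorelSpace Y] [Zero Y] {f : X → Y}
    {U : Set X} (hf : ContinuousOn f U) (hU : MeasurableSet U) : Measurable (U.indicator f) := by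
  refine measurable_of_restrict_of_restrict_compl hU ?_ ?_
  · convert hf.domRestrict.measurable using 1
    ext x
    simp
  · convert measurable_const (a := (0 : Y)) using 1
    ext x
    simpa using indicator_of_notMem x.2 f

theorem MeasureTheory.LocallyIntegrableOn.integrable_smul_of_tsupport_subset
    {X V : Type*} [TopologicalSpace X] [T2Space X] [MeasurableSpace X] [BorelSpace X]
    [SecondCountableTopology X] [NormedAddCommGroup V] [NormedSpace ℝ V] {μ : Measure X} {Ω : Set X}
    {F : X → V} (hF : LocallyIntegrableOn F Ω μ) {ψ : X → ℝ} (hψ : Continuous ψ)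
    (hc : HasCompactSupport ψ) (hs : tsupport ψ ⊆ Ω) : Integrable (fun x => ψ x • F x) μ := by
  have h1 : IntegrableOn F (tsupport ψ) μ := hF.integrableOn_compact_subset hs hc
  rw [← integrableOn_iff_integrable_of_support_subset (s := tsupport ψ)]
  · exact h1.continuousOn_smul hψ.continuousOn hc
  · exact (Function.support_smul_subset_left _ _).trans (subset_tsupport ψ)

/-! ### Weak derivatives and weak harmonicity -/

section IntegrationByParts

variable {n : ℕ} {m : ℕ} {Ω E : Set (EuclideanSpace ℂ (Fin n))} {f : EuclideanSpace ℂ (Fin n) → ℂ}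

/-- Integration by parts: `fderivOn (Ω \ E) f` is the weak derivative of `f` in `Ω`. -/
theorem integral_smul_fderivOn_apply (hm : Module.finrank ℝ (EuclideanSpace ℂ (Fin n)) = m + 1)
    (hE : Measure.hausdorffMeasure (m : ℝ) E = 0) (hU : IsOpen (Ω \ E))
    (hf : DifferentiableOn ℂ f (Ω \ E)) (hg : LocallyIntegrableOn (fderivOn (Ω \ E) f) Ω)
    (hfi : LocallyIntegrableOn f Ω) {ψ : EuclideanSpace ℂ (Fin n) → ℝ} (hψ : ContDiff ℝ 1 ψ)
    (hc : HasCompactSupport ψ) (hs : tsupport ψ ⊆ Ω) (v : EuclideanSpace ℂ (Fin n)) :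
    ∫ x, ψ x • fderivOn (Ω \ E) f x v = - ∫ x, fderiv ℝ ψ x v • f x := by
  set g := fderivOn (Ω \ E) f
  have hψ'c : Continuous fun x => fderiv ℝ ψ x v :=
    (hψ.continuous_fderiv one_ne_zero).clm_apply continuous_const
  have hi1 : Integrable fun x => ψ x • g x v := by
    have := (hg.integrable_smul_of_tsupport_subset hψ.continuous hc hs).apply_continuousLinearMap v
    simpa using this
  have hi2 : Integrable fun x => fderiv ℝ ψ x v • f x :=
    hfi.integrable_smul_of_tsupport_subset hψ'c (hc.fderiv_apply ℝ v)
      ((tsupport_fderiv_apply_subset ℝ v).trans hs)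
  have hi0 : Integrable fun x => ψ x • f x :=
    hfi.integrable_smul_of_tsupport_subset hψ.continuous hc hs
  -- The values of `f` on `E` are arbitrary, so the indicator is used to get a measurable integrand;
  -- it changes `f` only on a null set or where `ψ` vanishes.
  have hae : ∀ᵐ x, (Ω \ E).indicator f x = f x ∨ x ∉ Ω := by
    filter_upwards [measure_eq_zero_iff_ae_notMem.1 (volume_eq_zero_of_hausdorffMeasure hm hE)]
      with x hx
    by_cases hxΩ : x ∈ Ω
    · exact Or.inl (indicator_of_mem (mem_sdiff_of_mem hxΩ hx) f)
    · exact Or.inr hxΩ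
  have hzero : ∀ x ∉ Ω, fderiv ℝ ψ x v = 0 := fun x hx => by
    have : fderiv ℝ ψ x = 0 := image_eq_zero_of_notMem_tsupport fun h =>
      hx (hs (tsupport_fderiv_subset ℝ h))
    simp [this]
  have heq : (fun x => fderiv ℝ ψ x v • (Ω \ E).indicator f x) =ᵐ[volume]
      fun x => fderiv ℝ ψ x v • f x := by
    filter_upwards [hae] with x hx
    rcases hx with hx | hx
    · rw [hx]
    · simp [hzero x hx]
  have key : ∫ x, (ψ x • g x v + fderiv ℝ ψ x v • (Ω \ E).indicator f x) = 0 := by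
    refine integral_eq_zero_of_hasDerivAt_segment hi0 (hi1.add (hi2.congr heq.symm)) ?_ v ?_
    · refine Measurable.add ?_ ?_
      · exact hψ.continuous.measurable.smul
          ((ContinuousLinearMap.apply ℂ ℂ v).continuous.measurable.comp (measurable_fderivOn hU))
      · exact hψ'c.measurable.smul (hf.continuousOn.measurable_indicator hU.measurableSet)
    · filter_upwards [ae_add_smul_notMem (μ := volume) hm hE v] with x hx t ht
      have hline : HasDerivAt (fun τ : ℝ => x + τ • v) v t := by
        simpa using ((hasDerivAt_id t).smul_const v).const_add x
      by_cases hxΩ : x + t • v ∈ Ω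
      · have hmem : x + t • v ∈ Ω \ E := ⟨hxΩ, hx t ht⟩
        have h1 := hasDerivAt_segment_fderivOn hU hf hmem
        have h2 : HasDerivAt (fun τ : ℝ => ψ (x + τ • v)) (fderiv ℝ ψ (x + t • v) v) t :=
          ((hψ.differentiable one_ne_zero) _).hasFDerivAt.comp_hasDerivAt t hline
        rw [indicator_of_mem hmem]
        exact h2.smul h1
      · have h0 : ψ =ᶠ[𝓝 (x + t • v)] 0 :=
          notMem_tsupport_iff_eventuallyEq.1 fun h => hxΩ (hs h)
        have h3 : (fun τ : ℝ => ψ (x + τ • v) • f (x + τ • v)) =ᶠ[𝓝 t] fun _ => 0 := by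
          filter_upwards [hline.continuousAt.eventually h0] with τ hτ
          simp [hτ]
        rw [hzero _ hxΩ, h0.self_of_nhds]
        simpa using (hasDerivAt_const t (0 : ℂ)).congr_of_eventuallyEq h3
  rw [integral_add hi1 (hi2.congr heq.symm), integral_congr_ae heq] at key
  exact eq_neg_of_add_eq_zero_left key

/-- A second integration by parts puts both derivatives on `ψ`, where they commute. -/
theorem integral_fderiv_smul_fderivOn_comm
    (hm : Module.finrank ℝ (EuclideanSpace ℂ (Fin n)) = m + 1)
    (hE : Measure.hausdorffMeasure (m : ℝ) E = 0) (hU : IsOpen (Ω \ E))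
    (hf : DifferentiableOn ℂ f (Ω \ E)) (hg : LocallyIntegrableOn (fderivOn (Ω \ E) f) Ω)
    (hfi : LocallyIntegrableOn f Ω) {ψ : EuclideanSpace ℂ (Fin n) → ℝ} (hψ : ContDiff ℝ 2 ψ)
    (hc : HasCompactSupport ψ) (hs : tsupport ψ ⊆ Ω) (v w : EuclideanSpace ℂ (Fin n)) :
    ∫ x, fderiv ℝ ψ x v • fderivOn (Ω \ E) f x w =
      ∫ x, fderiv ℝ ψ x w • fderivOn (Ω \ E) f x v := by
  have hψ' : ContDiff ℝ 1 (fderiv ℝ ψ) := hψ.fderiv_right (by norm_num)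
  have h1 : ∀ v w, ∫ x, fderiv ℝ ψ x v • fderivOn (Ω \ E) f x w
      = - ∫ x, fderiv ℝ (fderiv ℝ ψ) x w v • f x := by
    intro v w
    rw [integral_smul_fderivOn_apply hm hE hU hf hg hfi (hψ'.clm_apply contDiff_const)
      (hc.fderiv_apply ℝ v) ((tsupport_fderiv_apply_subset ℝ v).trans hs) w]
    congr 2 with x
    rw [fderiv_clm_apply (hψ'.differentiable one_ne_zero x) (differentiableAt_const v)]
    simp
  rw [h1, h1]
  congr 2 with x
  rw [(hψ.contDiffAt (x := x)).isSymmSndFDerivAt (by simp) w v]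

/-- Weak harmonicity on the complex line of `v`: pull `I` out of `g`, exchange the directions `v`
and `I • v`, pull `I` out again, and `I * I = -1`. -/
theorem integral_fderiv_smul_fderivOn_add_I
    (hm : Module.finrank ℝ (EuclideanSpace ℂ (Fin n)) = m + 1)
    (hE : Measure.hausdorffMeasure (m : ℝ) E = 0) (hU : IsOpen (Ω \ E))
    (hf : DifferentiableOn ℂ f (Ω \ E)) (hg : LocallyIntegrableOn (fderivOn (Ω \ E) f) Ω)
    (hfi : LocallyIntegrableOn f Ω) {ψ : EuclideanSpace ℂ (Fin n) → ℝ} (hψ : ContDiff ℝ 2 ψ)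
    (hc : HasCompactSupport ψ) (hs : tsupport ψ ⊆ Ω) (v : EuclideanSpace ℂ (Fin n)) :
    (∫ x, fderiv ℝ ψ x v • fderivOn (Ω \ E) f x v) +
      ∫ x, fderiv ℝ ψ x (Complex.I • v) • fderivOn (Ω \ E) f x (Complex.I • v) = 0 := by
  have hI : ∀ u, ∫ x, fderiv ℝ ψ x u • fderivOn (Ω \ E) f x (Complex.I • v) =
      Complex.I * ∫ x, fderiv ℝ ψ x u • fderivOn (Ω \ E) f x v := by
    intro u
    rw [← integral_const_mul]
    congr 1 with x
    rw [map_smul, smul_eq_mul, mul_smul_comm]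
  rw [hI, integral_fderiv_smul_fderivOn_comm hm hE hU hf hg hfi hψ hc hs (Complex.I • v) v, hI,
    ← mul_assoc, Complex.I_mul_I]
  ring

end IntegrationByParts

/-! ### Radial bumps and their potentials -/

section RadialBump

theorem hasDerivAt_integral_expNegInvGlue (s : ℝ) :
    HasDerivAt (fun s => ∫ r in (0 : ℝ)..s, expNegInvGlue r) (expNegInvGlue s) s := by
  have hc : Continuous expNegInvGlue := (expNegInvGlue.contDiff (n := 0)).continuous
  exact intervalIntegral.integral_hasDerivAt_right (hc.intervalIntegrable _ _)
    (hc.stronglyMeasurableAtFilter _ _) hc.continuousAt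

theorem contDiff_integral_expNegInvGlue :
    ContDiff ℝ 2 (fun s => ∫ r in (0 : ℝ)..s, expNegInvGlue r) := by
  have h1 : (2 : WithTop ℕ∞) = 1 + 1 := by norm_num
  rw [h1, contDiff_succ_iff_deriv]
  refine ⟨fun s => (hasDerivAt_integral_expNegInvGlue s).differentiableAt, by simp, ?_⟩
  rw [funext fun s => (hasDerivAt_integral_expNegInvGlue s).deriv]
  exact expNegInvGlue.contDiff (n := 1)

theorem integral_expNegInvGlue_of_nonpos {s : ℝ} (hs : s ≤ 0) :
    ∫ r in (0 : ℝ)..s, expNegInvGlue r = 0 := by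
  refine (intervalIntegral.integral_congr (g := fun _ => 0) fun r hr => ?_).trans (by simp)
  rw [uIcc_of_ge hs] at hr
  exact expNegInvGlue.zero_of_nonpos hr.2

variable {X : Type*} [NormedAddCommGroup X] [InnerProductSpace ℝ X]

theorem contDiff_sub_mul_norm_sq (c a : ℝ) (z : X) {k : WithTop ℕ∞} :
    ContDiff ℝ k fun x : X => c - a * ‖x - z‖ ^ 2 :=
  contDiff_const.sub (contDiff_const.mul ((contDiff_id.sub contDiff_const).norm_sq ℝ))

theorem hasFDerivAt_comp_sub_mul_norm_sq {k : ℝ → ℝ} {k' : ℝ} (c a : ℝ) (z x : X)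
    (hk : HasDerivAt k k' (c - a * ‖x - z‖ ^ 2)) :
    HasFDerivAt (fun x : X => k (c - a * ‖x - z‖ ^ 2))
      ((-2 * a * k') • innerSL ℝ (x - z)) x := by
  have h1 : HasFDerivAt (fun x : X => ‖x - z‖ ^ 2) (2 • innerSL ℝ (x - z)) x := by
    simpa using ((hasFDerivAt_id x).sub_const z).norm_sq
  refine (hk.comp_hasFDerivAt x ((h1.const_mul a).const_sub c)).congr_fderiv ?_
  module

omit [InnerProductSpace ℝ X] in
theorem tsupport_comp_sub_mul_norm_sq_subset {k : ℝ → ℝ} (hk : ∀ s ≤ 0, k s = 0) {c a r : ℝ}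
    (ha : 0 ≤ a) (hr : 0 ≤ r) (hc : c ≤ a * r ^ 2) (z : X) :
    tsupport (fun x : X => k (c - a * ‖x - z‖ ^ 2)) ⊆ Metric.closedBall z r := by
  refine closure_minimal (fun x hx => ?_) Metric.isClosed_closedBall
  by_contra hxr
  rw [Metric.mem_closedBall, dist_eq_norm, not_le] at hxr
  refine hx (hk _ ?_)
  have : r ^ 2 ≤ ‖x - z‖ ^ 2 := by gcongr
  nlinarith

end RadialBump

/-! ### The mean value property off the exceptional set -/

section MeanValue

variable {n : ℕ} {m : ℕ} {Ω E : Set (EuclideanSpace ℂ (Fin n))} {f : EuclideanSpace ℂ (Fin n) → ℂ}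

/-- Expanding along the real orthonormal basis `e_k`, `I • e_k` turns the radial derivative into the
sum of terms that weak harmonicity kills in pairs. -/
theorem clm_apply_eq_sum_inner (L : EuclideanSpace ℂ (Fin n) →L[ℂ] ℂ)
    (y : EuclideanSpace ℂ (Fin n)) :
    L y = ∑ k, (inner ℝ y (EuclideanSpace.single k (1 : ℂ)) • L (EuclideanSpace.single k 1) +
      inner ℝ y (Complex.I • EuclideanSpace.single k (1 : ℂ)) •
        L (Complex.I • EuclideanSpace.single k 1)) := by
  conv_lhs => rw [EuclideanSpace.eq_sum_smul_single y, map_sum]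
  refine Finset.sum_congr rfl fun k _ => ?_
  have h1 : inner ℝ y (EuclideanSpace.single k (1 : ℂ)) = (y k).re := by
    simp [PiLp.inner_apply, Complex.inner, apply_ite]
  have h2 : inner ℝ y (Complex.I • EuclideanSpace.single k (1 : ℂ)) = (y k).im := by
    simp [PiLp.inner_apply, Complex.inner, apply_ite]
  rw [h1, h2, map_smul, map_smul, Complex.real_smul, Complex.real_smul, smul_eq_mul, smul_eq_mul]
  conv_lhs => rw [← Complex.re_add_im (y k)]
  ring

/-- The radial derivative of `f` has vanishing integral against radial bumps. -/
theorem integral_radial_smul_fderivOn_eq_zero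
    (hm : Module.finrank ℝ (EuclideanSpace ℂ (Fin n)) = m + 1)
    (hE : Measure.hausdorffMeasure (m : ℝ) E = 0) (hU : IsOpen (Ω \ E))
    (hf : DifferentiableOn ℂ f (Ω \ E)) (hg : LocallyIntegrableOn (fderivOn (Ω \ E) f) Ω)
    (hfi : LocallyIntegrableOn f Ω) {z : EuclideanSpace ℂ (Fin n)} {c a r : ℝ} (ha : 0 < a)
    (hr : 0 ≤ r) (hc : c ≤ a * r ^ 2) (hΩ : Metric.closedBall z r ⊆ Ω) :
    ∫ x, expNegInvGlue (c - a * ‖x - z‖ ^ 2) • fderivOn (Ω \ E) f x (x - z) = 0 := by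
  set g := fderivOn (Ω \ E) f
  -- A potential for the radial field: its gradient is `-2a` times the bump times `x - z`.
  set ψ : EuclideanSpace ℂ (Fin n) → ℝ := fun x =>
    ∫ s in (0 : ℝ)..(c - a * ‖x - z‖ ^ 2), expNegInvGlue s
  have hψ : ContDiff ℝ 2 ψ :=
    contDiff_integral_expNegInvGlue.comp (contDiff_sub_mul_norm_sq c a z)
  have hsupp : tsupport ψ ⊆ Metric.closedBall z r :=
    tsupport_comp_sub_mul_norm_sq_subset (fun s hs => integral_expNegInvGlue_of_nonpos hs)
      ha.le hr hc z
  have hcs : HasCompactSupport ψ :=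
    (isCompact_closedBall z r).of_isClosed_subset (isClosed_tsupport _) hsupp
  have hs := hsupp.trans hΩ
  have hψ' : ∀ x v, fderiv ℝ ψ x v =
      -2 * a * expNegInvGlue (c - a * ‖x - z‖ ^ 2) * inner ℝ (x - z) v := fun x v => by
    rw [(hasFDerivAt_comp_sub_mul_norm_sq c a z x (hasDerivAt_integral_expNegInvGlue _)).fderiv]
    rfl
  have hint : ∀ v, Integrable fun x => fderiv ℝ ψ x v • g x v := by
    intro v
    have h1 := hg.integrable_smul_of_tsupport_subset (ψ := fun x => fderiv ℝ ψ x v)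
      ((hψ.continuous_fderiv two_ne_zero).clm_apply continuous_const) (hcs.fderiv_apply ℝ v)
      ((tsupport_fderiv_apply_subset ℝ v).trans hs)
    simpa using h1.apply_continuousLinearMap v
  have hsum : (fun x => (-2 * a) •
      (expNegInvGlue (c - a * ‖x - z‖ ^ 2) • g x (x - z))) = fun x =>
      ∑ k, (fderiv ℝ ψ x (EuclideanSpace.single k 1) • g x (EuclideanSpace.single k 1) +
        fderiv ℝ ψ x (Complex.I • EuclideanSpace.single k 1) •
          g x (Complex.I • EuclideanSpace.single k 1)) := by
    ext x
    rw [clm_apply_eq_sum_inner, Finset.smul_sum, Finset.smul_sum]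
    refine Finset.sum_congr rfl fun k _ => ?_
    rw [hψ', hψ', smul_add, smul_add, smul_smul, smul_smul, smul_smul, smul_smul]
  have hzero : (-2 * a) • ∫ x, expNegInvGlue (c - a * ‖x - z‖ ^ 2) • g x (x - z) = 0 := by
    rw [← integral_smul, hsum, integral_finsetSum _ fun k _ => by
      simpa only using (hint (EuclideanSpace.single k 1)).fun_add
        (hint (Complex.I • EuclideanSpace.single k 1))]
    refine Finset.sum_eq_zero fun k _ => ?_
    rw [integral_add (hint _) (hint _)]
    exact integral_fderiv_smul_fderivOn_add_I hm hE hU hf hg hfi hψ hcs hs _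
  exact (smul_eq_zero.1 hzero).resolve_left (by simpa using ha.ne')

/-- Substituting `x = z + t • w` gives the previous integral with `a = t⁻²`; since `t ≤ 1`, the bump
remains supported in the ball of radius `ρ`. -/
theorem integral_radial_smul_fderivOn_ray_eq_zero
    (hm : Module.finrank ℝ (EuclideanSpace ℂ (Fin n)) = m + 1)
    (hE : Measure.hausdorffMeasure (m : ℝ) E = 0) (hU : IsOpen (Ω \ E))
    (hf : DifferentiableOn ℂ f (Ω \ E)) (hg : LocallyIntegrableOn (fderivOn (Ω \ E) f) Ω)
    (hfi : LocallyIntegrableOn f Ω) {z : EuclideanSpace ℂ (Fin n)} {ρ t : ℝ} (hρ : 0 ≤ ρ)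
    (ht : t ∈ Ioc (0 : ℝ) 1) (hΩ : Metric.closedBall z ρ ⊆ Ω) :
    ∫ w, expNegInvGlue (ρ ^ 2 - ‖w‖ ^ 2) • fderivOn (Ω \ E) f (z + t • w) w = 0 := by
  set g := fderivOn (Ω \ E) f
  have ht0 := ht.1.ne'
  have h1 := integral_radial_smul_fderivOn_eq_zero hm hE hU hf hg hfi (z := z) (c := ρ ^ 2)
    (a := (t ^ 2)⁻¹) (r := ρ) (by have := ht.1; positivity) hρ (by
      have : 1 ≤ (t ^ 2)⁻¹ := (one_le_inv₀ (by have := ht.1; positivity)).2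
        (pow_le_one₀ ht.1.le ht.2)
      nlinarith [sq_nonneg ρ]) hΩ
  set G := fun x => expNegInvGlue (ρ ^ 2 - (t ^ 2)⁻¹ * ‖x - z‖ ^ 2) • g x (x - z)
  have h2 : ∫ w, G (z + t • w) = 0 := by
    rw [Measure.integral_comp_smul volume (fun w => G (z + w)) t, integral_add_left_eq_self, h1,
      smul_zero]
  have h3 : ∀ w, G (z + t • w) =
      t • (expNegInvGlue (ρ ^ 2 - ‖w‖ ^ 2) • g (z + t • w) w) := by
    intro w
    have : (t ^ 2)⁻¹ * ‖t • w‖ ^ 2 = ‖w‖ ^ 2 := by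
      rw [norm_smul, mul_pow, Real.norm_eq_abs, sq_abs]
      field_simp
    simp only [G, add_sub_cancel_left, this]
    rw [← Complex.coe_smul t w, map_smul, Complex.coe_smul, smul_comm]
  simp only [h3, integral_smul] at h2
  exact (smul_eq_zero.1 h2).resolve_left ht0

/-- Mean value property with respect to a radial bump, off the exceptional set. -/
theorem integral_radial_smul_eq_of_mem
    (hm : Module.finrank ℝ (EuclideanSpace ℂ (Fin n)) = m + 1)
    (hE : Measure.hausdorffMeasure (m : ℝ) E = 0) (hU : IsOpen (Ω \ E))
    (hf : DifferentiableOn ℂ f (Ω \ E)) (hg : LocallyIntegrableOn (fderivOn (Ω \ E) f) Ω)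
    (hfi : LocallyIntegrableOn f Ω) {z : EuclideanSpace ℂ (Fin n)} (hz : z ∈ Ω \ E) {ρ : ℝ}
    (hρ : 0 ≤ ρ) (hΩ : Metric.closedBall z ρ ⊆ Ω) :
    ∫ x, expNegInvGlue (ρ ^ 2 - ‖x - z‖ ^ 2) • f x =
      (∫ w : EuclideanSpace ℂ (Fin n), expNegInvGlue (ρ ^ 2 - ‖w‖ ^ 2)) • f z := by
  set g := fderivOn (Ω \ E) f
  set φ : EuclideanSpace ℂ (Fin n) → ℝ := fun w => expNegInvGlue (ρ ^ 2 - ‖w‖ ^ 2)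
  set B := Metric.closedBall (0 : EuclideanSpace ℂ (Fin n)) ρ
  have hBm : MeasurableSet B := Metric.isClosed_closedBall.measurableSet
  have hφc : Continuous φ := (expNegInvGlue.contDiff (n := 0)).continuous.comp (by fun_prop)
  have hφ0 : ∀ w ∉ B, φ w = 0 := fun w hw => by
    refine expNegInvGlue.zero_of_nonpos ?_
    have : ρ < ‖w‖ := by simpa [B] using hw
    nlinarith
  have hset : ∀ F : EuclideanSpace ℂ (Fin n) → ℂ, ∫ w in B, φ w • F w = ∫ w, φ w • F w := fun F =>
    setIntegral_eq_integral_of_forall_compl_eq_zero fun w hw => by rw [hφ0 w hw, zero_smul]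
  have hgB : IntegrableOn g (Metric.closedBall z ρ) :=
    hg.integrableOn_compact_subset hΩ (isCompact_closedBall z ρ)
  have hray := integrable_fderivOn_ray_apply hU hf hz hgB
  have hrayφ : Integrable (fun p : EuclideanSpace ℂ (Fin n) × ℝ => φ p.1 • g (z + p.2 • p.1) p.1)
      ((volume.restrict B).prod (volume.restrict (Ioc 0 1))) := by
    refine hray.bdd_smul (expNegInvGlue (ρ ^ 2)) (hφc.comp continuous_fst).aestronglyMeasurable
      (Eventually.of_forall fun p => ?_)
    rw [Function.comp_apply, Real.norm_eq_abs, abs_of_nonneg (expNegInvGlue.nonneg _)]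
    exact expNegInvGlue.monotone (by nlinarith [sq_nonneg ‖p.1‖])
  -- After Fubini, the integral over `w` vanishes for each fixed `t`.
  have hswap : ∫ w in B, φ w • ∫ t in Ioc (0 : ℝ) 1, g (z + t • w) w = 0 := by
    simp only [← integral_smul]
    rw [integral_integral_swap hrayφ]
    refine (setIntegral_congr_fun measurableSet_Ioc fun t ht => ?_).trans (integral_zero _ _)
    exact (hset fun w => g (z + t • w) w).trans
      (integral_radial_smul_fderivOn_ray_eq_zero hm hE hU hf hg hfi hρ ht hΩ)
  have hφi : IntegrableOn φ B := hφc.continuousOn.integrableOn_compact (isCompact_closedBall 0 ρ)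
  calc ∫ x, expNegInvGlue (ρ ^ 2 - ‖x - z‖ ^ 2) • f x
      = ∫ w, φ w • f (z + w) := by
        rw [← integral_add_left_eq_self _ z]
        simp [φ]
    _ = ∫ w in B, φ w • f (z + w) := (hset _).symm
    _ = ∫ w in B, (φ w • f z + φ w • ∫ t in Ioc (0 : ℝ) 1, g (z + t • w) w) := by
        refine integral_congr_ae ?_
        filter_upwards [ae_sub_eq_integral_ray hm hE hU hf hz hΩ hgB] with w hw
        rw [← hw, ← smul_add, add_sub_cancel]
    _ = ∫ w in B, φ w • f z := by
        rw [integral_add (hφi.smul_const _), hswap, add_zero]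
        have := hrayφ.integral_prod_left
        simpa only [integral_smul] using this
    _ = (∫ w, φ w) • f z := by
        rw [hset fun _ => f z, integral_smul_const]

end MeanValue

/-! ### Holomorphic mollification and gluing -/

section Mollification

variable {n : ℕ} {m : ℕ} {Ω E : Set (EuclideanSpace ℂ (Fin n))} {f : EuclideanSpace ℂ (Fin n) → ℂ}

/-- Mollifying `f` with a radial bump produces a holomorphic function. -/
theorem differentiableAt_integral_radial_smul
    (hm : Module.finrank ℝ (EuclideanSpace ℂ (Fin n)) = m + 1)
    (hE : Measure.hausdorffMeasure (m : ℝ) E = 0) (hU : IsOpen (Ω \ E))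
    (hf : DifferentiableOn ℂ f (Ω \ E)) (hg : LocallyIntegrableOn (fderivOn (Ω \ E) f) Ω)
    (hfi : LocallyIntegrableOn f Ω) {z : EuclideanSpace ℂ (Fin n)} {ρ R : ℝ}
    (hρ : 0 ≤ ρ) (hρR : ρ < R) (hΩ : Metric.closedBall z R ⊆ Ω) :
    DifferentiableAt ℂ (fun y => ∫ x, expNegInvGlue (ρ ^ 2 - ‖x - y‖ ^ 2) • f x) z := by
  set g := fderivOn (Ω \ E) f
  set φ : EuclideanSpace ℂ (Fin n) → ℝ := fun w => expNegInvGlue (ρ ^ 2 - 1 * ‖w - 0‖ ^ 2)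
  have hφ : ContDiff ℝ 1 φ := (expNegInvGlue.contDiff (n := 1)).comp (contDiff_sub_mul_norm_sq _ _ _)
  have hφs : tsupport φ ⊆ Metric.closedBall 0 ρ :=
    tsupport_comp_sub_mul_norm_sq_subset (fun s hs => expNegInvGlue.zero_of_nonpos hs)
      zero_le_one hρ (by simp) 0
  have hφc : HasCompactSupport φ :=
    (isCompact_closedBall 0 ρ).of_isClosed_subset (isClosed_tsupport _) hφs
  set K := Metric.closedBall z R
  -- Convolution needs a function locally integrable on the whole space. For `y` within `R - ρ` of
  -- `z` the bump at `y` lives in `K`, so the cutoff changes nothing.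
  set fK := K.indicator f
  have hfK : LocallyIntegrable fK :=
    ((integrable_indicator_iff Metric.isClosed_closedBall.measurableSet).2
      (hfi.integrableOn_compact_subset hΩ (isCompact_closedBall z R))).locallyIntegrable
  set B : ℂ →L[ℝ] ℝ →L[ℝ] ℂ := (ContinuousLinearMap.lsmul ℝ ℝ).flip
  have hmem : ∀ y, dist y z < R - ρ → ∀ x, x ∉ K → y - x ∉ tsupport φ := by
    intro y hy x hx hxs
    have h1 := hφs hxs
    rw [Metric.mem_closedBall, dist_zero_right, ← dist_eq_norm] at h1
    refine hx ?_
    rw [Metric.mem_closedBall]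
    linarith [dist_triangle_left x z y]
  have heq : (fun y => ∫ x, expNegInvGlue (ρ ^ 2 - ‖x - y‖ ^ 2) • f x) =ᶠ[𝓝 z]
      convolution fK φ B volume := by
    filter_upwards [Metric.ball_mem_nhds z (sub_pos.2 hρR)] with y hy
    refine integral_congr_ae (Eventually.of_forall fun x => ?_)
    change _ = φ (y - x) • fK x
    have h1 : expNegInvGlue (ρ ^ 2 - ‖x - y‖ ^ 2) = φ (y - x) := by
      simp [φ, norm_sub_rev]
    by_cases hx : x ∈ K
    · simp only [fK, indicator_of_mem hx, h1]
    · simp only [h1, image_eq_zero_of_notMem_tsupport (hmem y hy x hx), zero_smul]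
  have hconv := hφc.hasFDerivAt_convolution_right B hfK hφ z
  set ψ : EuclideanSpace ℂ (Fin n) → ℝ := fun x => φ (z - x)
  have hψ : ContDiff ℝ 1 ψ := hφ.comp (contDiff_const.sub contDiff_id)
  have hψs : tsupport ψ ⊆ K := by
    refine (tsupport_comp_subset_preimage φ (by fun_prop)).trans fun x hx => ?_
    by_contra hxK
    exact hmem z (by simpa using hρR) x hxK hx
  have hψc : HasCompactSupport ψ :=
    (isCompact_closedBall z R).of_isClosed_subset (isClosed_tsupport _) hψs
  have hint := hg.integrable_smul_of_tsupport_subset hψ.continuous hψc (hψs.trans hΩ)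
  -- Integration by parts identifies the real derivative of the convolution with `∫ ψ • g`, which is
  -- complex linear.
  refine (hasFDerivAt_of_restrictScalars ℝ (f' := ∫ x, ψ x • g x)
    (hconv.congr_of_eventuallyEq heq) ?_).differentiableAt
  ext v
  have hex := (hφc.fderiv ℝ).convolutionExists_right (B.precompR (EuclideanSpace ℂ (Fin n))) hfK
    (hφ.continuous_fderiv one_ne_zero) z
  have h2 : ∀ x, fderiv ℝ ψ x v = - fderiv ℝ φ (z - x) v := by
    intro x
    have h3 : HasFDerivAt ψ _ x := ((hφ.differentiable one_ne_zero (z - x)).hasFDerivAt).comp x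
      ((hasFDerivAt_id x).const_sub z)
    rw [h3.fderiv]
    simp
  rw [ContinuousLinearMap.coe_restrictScalars', ContinuousLinearMap.integral_apply hint,
    convolution, ContinuousLinearMap.integral_apply hex]
  refine (integral_smul_fderivOn_apply hm hE hU hf hg hfi hψ hψc (hψs.trans hΩ) v).trans ?_
  rw [← integral_neg]
  refine integral_congr_ae (Eventually.of_forall fun x => ?_)
  change -(fderiv ℝ ψ x v • f x) = fderiv ℝ φ (z - x) v • fK x
  rw [h2, neg_smul, neg_neg]
  by_cases hx : x ∈ K
  · simp only [fK, indicator_of_mem hx]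
  · have : fderiv ℝ φ (z - x) = 0 := image_eq_zero_of_notMem_tsupport fun h =>
      hmem z (by simpa using hρR) x hx (tsupport_fderiv_subset ℝ h)
    simp [this]

theorem exists_ball_holomorphic_extension
    (hm : Module.finrank ℝ (EuclideanSpace ℂ (Fin n)) = m + 1)
    (hE : Measure.hausdorffMeasure (m : ℝ) E = 0) (hΩ : IsOpen Ω) (hU : IsOpen (Ω \ E))
    (hf : DifferentiableOn ℂ f (Ω \ E)) (hg : LocallyIntegrableOn (fderivOn (Ω \ E) f) Ω)
    {z₀ : EuclideanSpace ℂ (Fin n)} (hz₀ : z₀ ∈ Ω) :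
    ∃ r > 0, ∃ F : EuclideanSpace ℂ (Fin n) → ℂ, Metric.ball z₀ r ⊆ Ω ∧
      DifferentiableOn ℂ F (Metric.ball z₀ r) ∧ EqOn F f (Metric.ball z₀ r ∩ (Ω \ E)) := by
  have hfi := locallyIntegrableOn_of_fderivOn hm hE hΩ hU hf hg
  obtain ⟨ε, hε, hball⟩ := Metric.isOpen_iff.1 hΩ z₀ hz₀
  have hsub : ∀ z ∈ Metric.ball z₀ (ε / 4), Metric.closedBall z (ε / 2) ⊆ Ω := by
    intro z hz x hx
    refine hball ?_
    rw [Metric.mem_ball] at hz ⊢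
    rw [Metric.mem_closedBall] at hx
    linarith [dist_triangle x z z₀]
  set ρ := ε / 4
  have hρ : 0 < ρ := by positivity
  have hρε : ρ < ε / 2 := by simp only [ρ]; linarith
  set c := ∫ w : EuclideanSpace ℂ (Fin n), expNegInvGlue (ρ ^ 2 - ‖w‖ ^ 2)
  have hc : 0 < c := by
    have hcont : Continuous fun w : EuclideanSpace ℂ (Fin n) => expNegInvGlue (ρ ^ 2 - ‖w‖ ^ 2) :=
      (expNegInvGlue.contDiff (n := 0)).continuous.comp (by fun_prop)
    refine hcont.integral_pos_of_hasCompactSupport_nonneg_nonzero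
      ?_ (fun w => expNegInvGlue.nonneg _) (x := 0) ?_
    · have := tsupport_comp_sub_mul_norm_sq_subset (k := expNegInvGlue)
        (fun s hs => expNegInvGlue.zero_of_nonpos hs) zero_le_one hρ.le (c := ρ ^ 2) (by simp)
        (0 : EuclideanSpace ℂ (Fin n))
      simp only [one_mul, sub_zero] at this
      exact (isCompact_closedBall 0 ρ).of_isClosed_subset (isClosed_tsupport _) this
    · simpa using hρ.ne'
  refine ⟨ρ, hρ, fun z => c⁻¹ • ∫ x, expNegInvGlue (ρ ^ 2 - ‖x - z‖ ^ 2) • f x, ?_, ?_, ?_⟩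
  · exact (Metric.ball_subset_ball (by simp only [ρ]; linarith)).trans hball
  · intro z hz
    exact ((differentiableAt_integral_radial_smul hm hE hU hf hg hfi hρ.le hρε
      (hsub z hz)).const_smul c⁻¹).differentiableWithinAt
  · intro z hz
    simp only
    rw [integral_radial_smul_eq_of_mem hm hE hU hf hg hfi hz.2 hρ.le
      ((Metric.closedBall_subset_closedBall hρε.le).trans (hsub z hz.1)), smul_smul,
      inv_mul_cancel₀ hc.ne', one_smul]

/-- Each local extension is continuous and equals `f` on a dense set, so its values are the limits
of `f` along `Ω \ E`; `extendFrom` thus glues them all. -/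
theorem exists_holomorphic_extension_of_locallyIntegrableOn_fderivOn
    (hm : Module.finrank ℝ (EuclideanSpace ℂ (Fin n)) = m + 1)
    (hE : Measure.hausdorffMeasure (m : ℝ) E = 0) (hΩ : IsOpen Ω) (hU : IsOpen (Ω \ E))
    (hf : DifferentiableOn ℂ f (Ω \ E)) (hg : LocallyIntegrableOn (fderivOn (Ω \ E) f) Ω) :
    ∃ F : EuclideanSpace ℂ (Fin n) → ℂ, DifferentiableOn ℂ F Ω ∧ EqOn F f (Ω \ E) := by
  have hdense := subset_closure_diff_of_volume_eq_zero hΩ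
    (volume_eq_zero_of_hausdorffMeasure hm hE)
  refine ⟨extendFrom (Ω \ E) f, fun z₀ hz₀ => ?_, fun z hz => ?_⟩
  · obtain ⟨r, hr, F, hsub, hF, heq⟩ := exists_ball_holomorphic_extension hm hE hΩ hU hf hg hz₀
    have hnhds := Metric.isOpen_ball.mem_nhds (Metric.mem_ball_self hr : z₀ ∈ Metric.ball z₀ r)
    refine (((hF z₀ (Metric.mem_ball_self hr)).differentiableAt hnhds).congr_of_eventuallyEq
      ?_).differentiableWithinAt
    filter_upwards [hnhds] with z hz
    have hzn := Metric.isOpen_ball.mem_nhds hz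
    refine extendFrom_eq (hdense (hsub hz)) ?_
    refine (((hF z hz).differentiableAt hzn).continuousAt.continuousWithinAt).tendsto.congr' ?_
    filter_upwards [mem_nhdsWithin_of_mem_nhds hzn, self_mem_nhdsWithin] with y hy1 hy2
    exact heq ⟨hy1, hy2⟩
  · exact extendFrom_eq (subset_closure hz) (hf z hz).continuousWithinAt

end Mollification

theorem theorem5 (n : ℕ) (hn : 1 ≤ n) (Ω E : Set (EuclideanSpace ℂ (Fin n)))
    (hΩ_open : IsOpen Ω) (hΩ_conn : IsConnected Ω)
    (hEΩ : E ⊆ Ω) (hE_closed : IsClosed ((↑) ⁻¹' E : Set Ω))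
    (hE : Measure.hausdorffMeasure (2 * (n : ℝ) - 1) E = 0)
    (f : EuclideanSpace ℂ (Fin n) → ℂ) (hf : DifferentiableOn ℂ f (Ω \ E))
    (hL2 : ∀ j : Fin n × Fin 2, MemLpLocOn 2 (realPartialDeriv j f) Ω) :
    ∃ F : EuclideanSpace ℂ (Fin n) → ℂ,
      DifferentiableOn ℂ F Ω ∧ EqOn F f (Ω \ E) := by
  -- The subtraction is in `ℕ`; `1 ≤ n` keeps it from truncating.
  have hm : Module.finrank ℝ (EuclideanSpace ℂ (Fin n)) = (2 * n - 1) + 1 := by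
    rw [← Module.finrank_mul_finrank ℝ ℂ]
    simp
    omega
  have hcast : ((2 * n - 1 : ℕ) : ℝ) = 2 * (n : ℝ) - 1 := by
    rw [Nat.cast_sub (by omega)]
    push_cast
    ring
  rw [← hcast] at hE
  have hU : IsOpen (Ω \ E) := by
    have := hΩ_open.isOpenMap_subtype_val _ hE_closed.isOpen_compl
    rwa [← preimage_compl, Subtype.image_preimage_coe, ← sdiff_eq] at this
  exact exists_holomorphic_extension_of_locallyIntegrableOn_fderivOn hm hE hΩ_open hU hf
    (locallyIntegrableOn_fderivOn hΩ_open hU hf hL2)
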